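/- Let $T$ and $T'$ be two non-isomorphic (finite) trees whose adjacency matrices have the same characteristic polynomial $\phi(x)=\det(xI-A(T))=\det(xI-A(T'))\in\mathbb{Z}[x]$, and suppose that $\phi$ is irreducible over $\mathbb{Q}$. Let $n$ be the number of vertices of $T$, let $\alpha_1,\dots,\alpha_n$ be the roots of $\phi$, and let $\Delta(T)=\prod_{1\le i<j\le n}(\alpha_i-\alpha_j)^2$ be the discriminant of $\phi$. Suppose that $2^{-n/2}\sqrt{\Delta(T)}$ is an odd square-free integer. Then no signed tree $\Gamma$ with underlying graph $T$ is generalized cospectral with a signed tree $\Gamma'$ with underlying graph $T'$. Here a signed graph $\Gamma$ with underlying graph $G$ is obtained from $G$ by assigning a sign $1$ or $-1$ to each edge. Its adjacency matrix $A(\Gamma)$ has as $(i,j)$ entry the sign of the edge $ij$ if $i$ and $j$ are adjacent in $G$, and $0$ otherwise. Two signed graphs $\Gamma$ and $\Gamma'$ are generalized cospectral if $\det(xI-A(\Gamma))=\det(xI-A(\Gamma'))$ and $\det(xI-(J-I-A(\Gamma)))=\det(xI-(J-I-A(\Gamma')))$, where $J$ is the all-one matrix and $I$ the identity matrix. -/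

import Mathlib

/-- A signed graph: a simple graph together with a sign `1` or `-1` on each of its edges. -/
structure SignedGraph (V : Type*) where
  /-- the underlying graph -/
  underlying : SimpleGraph V
  /-- the signature -/
  sign : underlying.edgeSet → ℤˣ

open Classical in
/-- The adjacency matrix of a signed graph: the `(i, j)` entry is the sign of the edge `ij` if
`i` and `j` are adjacent, and `0` otherwise. -/
noncomputable def SignedGraph.adjMatrix {V : Type*} (Γ : SignedGraph V) : Matrix V V ℤ :=
  Matrix.of fun i j =>
    if h : Γ.underlying.Adj i j then ((Γ.sign ⟨s(i, j), h⟩ : ℤˣ) : ℤ) else 0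

/-- The formal complement `J - I - A(Γ)` of a signed graph, where `J` is the all-one matrix. -/
noncomputable def SignedGraph.complMatrix {V : Type*} [DecidableEq V] (Γ : SignedGraph V) :
    Matrix V V ℤ :=
  Matrix.of (fun _ _ => 1) - 1 - Γ.adjMatrix

/-- Two signed graphs are generalized cospectral if they have the same characteristic polynomial
and their formal complements have the same characteristic polynomial. -/
def SignedGraph.GeneralizedCospectral {V W : Type*} [Fintype V] [DecidableEq V]
    [Fintype W] [DecidableEq W] (Γ : SignedGraph V) (Γ' : SignedGraph W) : Prop :=
  Γ.adjMatrix.charpoly = Γ'.adjMatrix.charpoly ∧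
    Γ.complMatrix.charpoly = Γ'.complMatrix.charpoly

/-- The characteristic polynomial `det (x I - A(G))` of a graph, with integer coefficients. -/
noncomputable def SimpleGraph.charPoly {V : Type*} [Fintype V] [DecidableEq V]
    (G : SimpleGraph V) [DecidableRel G.Adj] : Polynomial ℤ :=
  (G.adjMatrix ℤ).charpoly

/-- The discriminant of a graph: the discriminant of its characteristic polynomial. -/
noncomputable def SimpleGraph.discriminant {V : Type*} [Fintype V] [DecidableEq V]
    (G : SimpleGraph V) [DecidableRel G.Adj] : ℤ :=
  G.charPoly.discr

/-!
Let `φ` be the common characteristic polynomial, `α` a root of `φ` and `K = ℚ(α)`. All signatures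
of a tree are switching equivalent, so `φ` is also the characteristic polynomial of `A(Γ)` and
`A(Γ')`. Since `φ` is irreducible, the all-one vector is cyclic for `A(Γ)`, and `f(α) ↦ f(A(Γ)) 1`
identifies `K` with `ℚ^V` (`Matrix.exists_cyclic_equiv`). The scalar product becomes `(x, y) ↦ t
(x * y)`, where `t(f(α)) = 1ᵀ f(A(Γ)) 1`, and `ℤ^V` becomes a `ℤ[α]`-lattice `L` in `K` that is
self-dual for this form. In the same way `Γ'` yields a lattice `L'` and a linear form `t'`. If the
signed trees are generalized cospectral, then `t = t'` (`Matrix.walkForm_eq`).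

The bipartition of `T` induces an involutive isometry `δ` of `K` that anticommutes with `α` and
splits `L`. The one induced by `T'` is `δ` or `-δ` (`PowerBasis.IsGrading.eq_or_eq_neg`), because
their composition is the multiplication by an element of `K` with square `1`; hence `δ` splits
`L'` as well. Each eigenspace of `δ` is a line over `F = ℚ(α ^ 2)`, in which `L` and `L'` cut out
`ℤ[α ^ 2]`-modules that are self-dual for the same form.

Now `φ(x) = g(x ^ 2)` and `discr φ = ± 2 ^ n N(α) (discr g) ^ 2`, so the hypothesis makes `discr
g` squarefree (`PowerBasis.squarefree_discr_adjoin_sq`) and `ℤ[α ^ 2]` is the ring of integers of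
`F` (`NumberField.mem_adjoin_of_squarefree_discr`). Self-dual fractional ideals `I`, `J` of a
Dedekind domain satisfy `I ^ 2 = J ^ 2`, hence `I = J` (`Submodule.le_of_self_dual`). Therefore `L
= L'` (`PowerBasis.IsSelfDual.le`). The resulting isometry `ℤ^V ≃ ℤ^W` is a signed permutation
carrying `A(Γ)` to `A(Γ')` (`exists_equiv_of_integralLattice_le`), so `T` and `T'` are isomorphic.
-/

/-! ### Signs on the edges of a tree -/

/-- Every assignment of signs to the edges of a tree is the coboundary of an assignment of signs to
its vertices: multiply the signs along the path from a root. -/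
theorem SimpleGraph.IsTree.exists_potential {V : Type*} {T : SimpleGraph V} (hT : T.IsTree)
    (c : V → V → ℤˣ) (hc : ∀ u v, c u v = c v u) :
    ∃ d : V → ℤˣ, ∀ u v, T.Adj u v → d u * d v = c u v := by
  classical
  obtain ⟨r⟩ := hT.connected.nonempty
  let wt : ∀ {u v : V}, T.Walk u v → ℤˣ := fun p => (p.darts.map fun a => c a.fst a.snd).prod
  have wt_concat {u v w : V} (p : T.Walk u v) (h : T.Adj v w) : wt (p.concat h) = wt p * c v w := by
    simp [wt, SimpleGraph.Walk.darts_concat]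
  choose p hp _ using fun v => hT.existsUnique_path r v
  refine ⟨fun v => wt (p v), fun u v huv => ?_⟩
  beta_reduce at hp ⊢
  by_cases hu : u ∈ (p v).support
  · rw [hT.isAcyclic.path_concat (hp u) (hp v) huv hu, wt_concat, ← mul_assoc, Int.units_mul_self,
      one_mul]
  · have hv : v ∈ (p u).support :=
      hT.isAcyclic.mem_support_of_ne_mem_support_of_adj_of_isPath (hp u) (hp v) huv hu
    rw [hT.isAcyclic.path_concat (hp v) (hp u) huv.symm hv, wt_concat, mul_right_comm,
      Int.units_mul_self, one_mul, hc]

/-! ### Self-dual fractional ideals -/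

open scoped nonZeroDivisors in
/-- Over a Dedekind domain, a fractional ideal that is its own dual for the form
`(x, y) ↦ τ (x * y)` is unique: any two such ideals `A`, `B` satisfy `A ^ 2 = B ^ 2`, and fractional
ideals have at most one square root. The statement is one inclusion; the other is its mirror
image. -/
theorem Submodule.le_of_self_dual {R F : Type*} [CommRing R] [IsDedekindDomain R] [Field F]
    [Algebra R F] [IsFractionRing R F] (τ : F →+ ℚ) {I J : Submodule R F} (hIfg : I.FG)
    (hJfg : J.FG)
    (hI : ∀ x, x ∈ I ↔ ∀ y ∈ I, ∃ k : ℤ, τ (x * y) = k)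
    (hJ : ∀ x, x ∈ J ↔ ∀ y ∈ J, ∃ k : ℤ, τ (x * y) = k) : I ≤ J := by
  have ne_bot : ∀ N : Submodule R F, (∀ x, x ∈ N ↔ ∀ y ∈ N, ∃ k : ℤ, τ (x * y) = k) → N ≠ ⊥ := by
    rintro N hN rfl
    exact one_ne_zero ((Submodule.mem_bot R).1 ((hN 1).2 fun y hy => ⟨0, by
      simp [(Submodule.mem_bot R).1 hy]⟩))
  let A : FractionalIdeal R⁰ F := ⟨I, FractionalIdeal.isFractional_of_fg hIfg⟩
  let B : FractionalIdeal R⁰ F := ⟨J, FractionalIdeal.isFractional_of_fg hJfg⟩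
  have hA0 : A ≠ 0 := fun h => ne_bot I hI (by
    simpa [A] using congrArg (fun a : FractionalIdeal R⁰ F => (a : Submodule R F)) h)
  have hB0 : B ≠ 0 := fun h => ne_bot J hJ (by
    simpa [B] using congrArg (fun a : FractionalIdeal R⁰ F => (a : Submodule R F)) h)
  have mem_mul : ∀ C : FractionalIdeal R⁰ F,
      (∀ x, x ∈ C ↔ ∀ y ∈ C, ∃ k : ℤ, τ (x * y) = k) →
      ∀ z ∈ C * C, ∃ k : ℤ, τ z = k := by
    intro C hC z hz
    refine FractionalIdeal.mul_induction_on hz (fun i hi j hj => (hC i).1 hi j hj) ?_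
    rintro x y ⟨a, ha⟩ ⟨b, hb⟩
    exact ⟨a + b, by simp [ha, hb]⟩
  -- `D * D` is contained in the largest ideal on which `τ` is integral, and `C` contains every
  -- ideal whose product with `C` is contained in that one.
  have sq_le : ∀ C D : FractionalIdeal R⁰ F, C ≠ 0 →
      (∀ x, x ∈ C ↔ ∀ y ∈ C, ∃ k : ℤ, τ (x * y) = k) →
      (∀ x, x ∈ D ↔ ∀ y ∈ D, ∃ k : ℤ, τ (x * y) = k) → D * D ≤ C * C := by
    intro C D hC0 hC hD
    have h : D * D * C⁻¹ ≤ C := by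
      intro x hx
      refine (hC x).2 fun y hy => mem_mul D hD _ ?_
      have := FractionalIdeal.mul_mem_mul hx hy
      rwa [mul_assoc, inv_mul_cancel₀ hC0, mul_one] at this
    calc D * D = D * D * C⁻¹ * C := by rw [mul_assoc, inv_mul_cancel₀ hC0, mul_one]
      _ ≤ C * C := by gcongr
  have hsq : A * A = B * B := le_antisymm (sq_le B A hB0 hJ hI) (sq_le A B hA0 hI hJ)
  have hAB : A ≤ B := by
    -- `(A + B) ^ 3 = B ^ 2 * (A + B)` as addition of fractional ideals is idempotent, and
    -- cancelling `A + B` leaves `A * B ≤ (A + B) ^ 2 = B ^ 2`.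
    have h3 : (A + B) * (A + B) * (A + B) = B * B * (A + B) := by
      have : (A + B) * (A + B) * (A + B) = (A * A + A * B + B * B) * (A + B) := by
        have e : ∀ x y z : FractionalIdeal R⁰ F, x + x + y + z = x + y + z := by
          intro x y z; rw [← FractionalIdeal.sup_eq_add x x, sup_idem]
        have : (A + B) * (A + B) = A * B + A * B + A * A + B * B := by ring
        rw [this, e]; ring
      rw [this]
      calc (A * A + A * B + B * B) * (A + B)
          = (A * A) * A + (A * A) * B + (A * A) * B + A * (B * B) + A * (B * B) + B * B * B := by
            ring
        _ = B * B * (A + B) + (B * B * (A + B) + B * B * (A + B)) := by rw [hsq]; ring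
        _ = B * B * (A + B) := by simp only [← FractionalIdeal.sup_eq_add, sup_idem]
    have hAB0 : A + B ≠ 0 := fun h => hB0 (le_antisymm (h ▸ (by
      rw [← FractionalIdeal.sup_eq_add]; exact le_sup_right)) (zero_le (a := B)))
    have h2 := mul_right_cancel₀ hAB0 h3
    have : A * B ≤ B * B := by
      rw [← h2]
      gcongr <;> rw [← FractionalIdeal.sup_eq_add]
      exacts [le_sup_left, le_sup_right]
    calc A = A * B * B⁻¹ := by rw [mul_assoc, mul_inv_cancel₀ hB0, mul_one]
      _ ≤ B * B * B⁻¹ := by gcongr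
      _ = B := by rw [mul_assoc, mul_inv_cancel₀ hB0, mul_one]
  exact hAB

/-! ### Discriminants and maximality of `ℤ[α ^ 2]` -/

open NumberField in
/-- If the discriminant of an integral power basis is squarefree, the generator generates the ring
of integers: the square of the index divides the discriminant. -/
theorem NumberField.mem_adjoin_of_squarefree_discr {F : Type*} [Field F] [NumberField F]
    (pb : PowerBasis ℚ F) (hint : IsIntegral ℤ pb.gen) {d : ℤ} (hd : Squarefree d)
    (hdisc : Algebra.discr ℚ pb.basis = d) (x : 𝓞 F) : (x : F) ∈ Algebra.adjoin ℤ {pb.gen} := by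
  classical
  let b := RingOfIntegers.basis F
  obtain ⟨g, hg⟩ : ∃ g : 𝓞 F, algebraMap (𝓞 F) F g = pb.gen := ⟨⟨pb.gen, hint⟩, rfl⟩
  have hcard : Fintype.card (Module.Free.ChooseBasisIndex ℤ (𝓞 F)) = Fintype.card (Fin pb.dim) := by
    rw [← Module.finrank_eq_card_chooseBasisIndex, RingOfIntegers.rank, pb.finrank,
      Fintype.card_fin]
  let e := Fintype.equivOfCardEq hcard
  let B : Module.Free.ChooseBasisIndex ℤ (𝓞 F) → 𝓞 F := fun i => g ^ (e i : ℕ)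
  have h1 := Algebra.discr_of_matrix_vecMul b (b.toMatrix B)
  rw [Module.Basis.toMatrix_map_vecMul] at h1
  have h2 : Algebra.discr ℤ B = d := by
    have : ((Algebra.discr ℤ B : ℤ) : ℚ) = Algebra.discr ℚ pb.basis := by
      rw [← Algebra.discr_reindex ℚ pb.basis e.symm]
      rw [Algebra.discr_def, Algebra.discr_def, ← eq_intCast (Int.castRingHom ℚ), RingHom.map_det]
      congr 1
      ext i j
      have h := Algebra.trace_localization ℤ (nonZeroDivisors ℤ) (Rₘ := ℚ) (Sₘ := F) (B i * B j)
      simpa [Algebra.traceMatrix_apply, Algebra.traceForm_apply, B, hg] using h.symm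
    exact_mod_cast this.trans hdisc
  -- the determinant of the change of basis is the index up to sign
  have h3 : IsUnit (b.toMatrix B).det := by
    refine hd _ ⟨Algebra.discr ℤ b, ?_⟩
    rw [← h2, h1, sq]
  have h4 : x ∈ Submodule.span ℤ (Set.range B) := by
    have := ((Module.Basis.is_basis_iff_det b (v := B)).2 (by rwa [Module.Basis.det_apply])).2
    rw [this]; trivial
  have hB : ∀ i, algebraMap (𝓞 F) F (B i) ∈ Algebra.adjoin ℤ {pb.gen} := fun i => by
    simp only [B, map_pow, hg]
    exact Subalgebra.pow_mem _ (Algebra.self_mem_adjoin_singleton ℤ _) _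
  clear_value B
  obtain ⟨c, rfl⟩ := (Submodule.mem_span_range_iff_exists_fun ℤ).1 h4
  have hsum : algebraMap (𝓞 F) F (∑ i, c i • B i) = ∑ i, (c i : F) * algebraMap (𝓞 F) F (B i) := by
    simp only [map_sum, zsmul_eq_mul, map_mul, map_intCast]
  change algebraMap (𝓞 F) F _ ∈ _
  rw [hsum]
  exact Subalgebra.sum_mem _ fun i _ =>
    Subalgebra.mul_mem _ (Subalgebra.intCast_mem _ _) (hB i)

section DiscriminantOfSquare

open Polynomial IntermediateField

/-- The discriminant of the minimal polynomial is the discriminant of the power basis: both are,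
up to the same sign, the norm of the derivative of the polynomial at its root. -/
theorem PowerBasis.discr_minpoly {K : Type*} [Field K] [NumberField K] (pb : PowerBasis ℚ K)
    {P : ℤ[X]} (hP : P.Monic) (hmin : P.map (Int.castRingHom ℚ) = minpoly ℚ pb.gen) :
    (P.discr : ℚ) = Algebra.discr ℚ pb.basis := by
  classical
  let E := AlgebraicClosure ℚ
  have hdeg : P.natDegree = pb.dim := by
    rw [← pb.natDegree_minpoly, ← hmin, hP.natDegree_map]
  have hpos : 0 < P.degree := natDegree_pos_iff_degree_pos.1 (hdeg ▸ pb.dim_pos)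
  have hres := resultant_deriv hpos
  have hnorm : ((resultant P P.derivative P.natDegree (P.natDegree - 1) : ℤ) : ℚ) =
      Algebra.norm ℚ (aeval pb.gen (minpoly ℚ pb.gen).derivative) := by
    apply (algebraMap ℚ E).injective
    have hmap : P.map (algebraMap ℤ E) = (minpoly ℚ pb.gen).map (algebraMap ℚ E) := by
      rw [← hmin, Polynomial.map_map]; congr 1
    have h1 : algebraMap ℚ E ((resultant P P.derivative P.natDegree (P.natDegree - 1) : ℤ) : ℚ) =
        resultant (P.map (algebraMap ℤ E)) (P.map (algebraMap ℤ E)).derivative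
          (P.map (algebraMap ℤ E)).natDegree (P.natDegree - 1) := by
      rw [derivative_map, resultant_map_map, hP.natDegree_map]; simp
    rw [h1, resultant_eq_prod_eval _ _ _ ?_ (IsAlgClosed.splits _)]
    · rw [Algebra.norm_eq_prod_embeddings, (hP.map _).leadingCoeff, one_pow, one_mul, hmap]
      have hroots : ((minpoly ℚ pb.gen).map (algebraMap ℚ E)).roots =
          (Finset.univ.val : Multiset (K →ₐ[ℚ] E)).map (fun σ => σ pb.gen) := by
        have hnd : (Multiset.map (fun σ : K →ₐ[ℚ] E => σ pb.gen) Finset.univ.val).Nodup :=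
          (Multiset.nodup_map_iff_of_injective fun σ τ h => pb.algHom_ext h).2 Finset.univ.nodup
        symm
        apply Multiset.eq_of_le_of_card_le
        · rw [Multiset.le_iff_subset hnd]
          intro y hy
          obtain ⟨σ, -, rfl⟩ := Multiset.mem_map.1 hy
          rw [mem_roots', IsRoot.def, eval_map_algebraMap, aeval_algHom_apply, minpoly.aeval,
            map_zero]
          exact ⟨map_monic_ne_zero (minpoly.monic pb.isIntegral_gen), rfl⟩
        · refine (card_roots' _).trans ?_
          rw [(minpoly.monic pb.isIntegral_gen).natDegree_map, Multiset.card_map]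
          change _ ≤ Fintype.card (K →ₐ[ℚ] E)
          rw [AlgHom.card, pb.natDegree_minpoly, pb.finrank]
      rw [hroots, Multiset.map_map]
      change ∏ σ : K →ₐ[ℚ] E, _ = _
      refine Finset.prod_congr rfl fun σ _ => ?_
      rw [Function.comp_apply, derivative_map, eval_map_algebraMap, aeval_algHom_apply]
    · refine (natDegree_derivative_le _).trans ?_
      rw [hP.natDegree_map]
  rw [Algebra.discr_powerBasis_eq_norm, ← hnorm, hres, hP.leadingCoeff, hdeg, pb.finrank]
  push_cast
  rw [mul_one, ← mul_assoc, ← pow_add, ← two_mul, pow_mul, neg_one_sq, one_pow, one_mul]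

theorem PowerBasis.finrank_adjoin_sq {K : Type*} [Field K] [NumberField K] (pb : PowerBasis ℚ K)
    (hmem : pb.gen ∉ ℚ⟮pb.gen ^ 2⟯) : Module.finrank ℚ⟮pb.gen ^ 2⟯ K = 2 := by
  set F := ℚ⟮pb.gen ^ 2⟯ with hF
  let β : F := ⟨pb.gen ^ 2, mem_adjoin_simple_self ℚ _⟩
  have htop : F⟮pb.gen⟯ = ⊤ := by
    rw [eq_top_iff]
    intro x _
    obtain ⟨p, rfl⟩ := pb.exists_eq_aeval' x
    have h1 : aeval pb.gen p = aeval pb.gen (p.map (algebraMap ℚ F)) := by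
      rw [aeval_map_algebraMap]
    rw [h1]
    exact algebra_adjoin_le_adjoin F _ (aeval_mem_adjoin_singleton F _)
  have hint : IsIntegral F pb.gen := Algebra.IsIntegral.isIntegral _
  have h1 : Module.finrank F K = (minpoly F pb.gen).natDegree := by
    rw [← adjoin.finrank hint, htop, finrank_top']
  have hle : (minpoly F pb.gen).natDegree ≤ 2 := by
    have hm : (X ^ 2 - C β : F[X]).Monic := monic_X_pow_sub_C _ two_ne_zero
    have := natDegree_le_of_dvd (minpoly.dvd F pb.gen (p := X ^ 2 - C β) (by simp [β])) hm.ne_zero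
    rwa [natDegree_X_pow_sub_C] at this
  have hpos : 0 < (minpoly F pb.gen).natDegree := minpoly.natDegree_pos hint
  have hne : (minpoly F pb.gen).natDegree ≠ 1 := by
    intro h
    obtain ⟨y, hy⟩ := minpoly.natDegree_eq_one_iff.1 h
    exact hmem (hy ▸ y.2)
  omega

/-- Let `α ∉ F = ℚ(α ^ 2)` have minimal polynomial `P(x) = g(x ^ 2)`. Then `P'(α) = 2 α g'(α ^ 2)`,
and taking norms gives `discr P = ± 2 ^ n N(α) (discr g) ^ 2`. So if `discr P = 2 ^ n k ^ 2`, then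
`discr g` divides `k`. -/
theorem PowerBasis.squarefree_discr_adjoin_sq {K : Type*} [Field K] [NumberField K]
    (pb : PowerBasis ℚ K) (hmem : pb.gen ∉ ℚ⟮pb.gen ^ 2⟯) {P : ℤ[X]} (hP : P.Monic)
    (hmin : P.map (Int.castRingHom ℚ) = minpoly ℚ pb.gen) {k : ℤ} (hk : Squarefree k)
    (hdisc : P.discr = 2 ^ pb.dim * k ^ 2) :
    ∃ d : ℤ, Squarefree d ∧ Algebra.discr ℚ
      (adjoin.powerBasis (Algebra.IsIntegral.isIntegral (R := ℚ) (pb.gen ^ 2))).basis = d := by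
  set F := ℚ⟮pb.gen ^ 2⟯ with hF
  set pbF : PowerBasis ℚ F :=
      adjoin.powerBasis (Algebra.IsIntegral.isIntegral (R := ℚ) (pb.gen ^ 2))
    with hpbF
  have hintα : IsIntegral ℤ pb.gen :=
    ⟨P, hP, by
      have := minpoly.aeval ℚ pb.gen
      rwa [← hmin, aeval_def, eval₂_map, RingHom.ext_int ((algebraMap ℚ K).comp _) _] at this⟩
  have hgen : (algebraMap F K) pbF.gen = pb.gen ^ 2 := rfl
  have hintβ : IsIntegral ℤ pbF.gen := by
    rw [← isIntegral_algebraMap_iff (algebraMap F K).injective, hgen]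
    exact hintα.pow 2
  have hrank := pb.finrank_adjoin_sq hmem
  obtain ⟨d, hd⟩ : ∃ d : ℤ, algebraMap ℤ ℚ d = Algebra.discr ℚ pbF.basis := by
    refine IsIntegrallyClosed.isIntegral_iff.1 (Algebra.discr_isIntegral ℚ fun i => ?_)
    rw [pbF.basis_eq_pow]
    exact hintβ.pow _
  obtain ⟨a, ha⟩ : ∃ a : ℤ, algebraMap ℤ ℚ a = Algebra.norm ℚ pb.gen :=
    IsIntegrallyClosed.isIntegral_iff.1 (Algebra.isIntegral_norm ℚ hintα)
  have hmin2 : minpoly ℚ pb.gen = expand ℚ 2 (minpoly ℚ pbF.gen) := by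
    refine (eq_of_monic_of_dvd_of_natDegree_le (minpoly.monic pb.isIntegral_gen)
      ((minpoly.monic pbF.isIntegral_gen).expand two_pos) (minpoly.dvd _ _ ?_) ?_).symm
    · rw [expand_aeval, ← hgen, aeval_algebraMap_apply, minpoly.aeval, map_zero]
    · rw [natDegree_expand, pb.natDegree_minpoly, pbF.natDegree_minpoly, ← pb.finrank,
        ← pbF.finrank, ← hrank, Module.finrank_mul_finrank]
  set z := aeval pbF.gen (derivative (minpoly ℚ pbF.gen)) with hz
  have hderiv : aeval pb.gen (derivative (minpoly ℚ pb.gen)) =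
      algebraMap F K z * (algebraMap ℚ K 2 * pb.gen) := by
    rw [hmin2, derivative_expand, map_mul, expand_aeval, ← hgen, aeval_algebraMap_apply, ← hz]
    have h2 : aeval pb.gen (2 : ℚ[X]) = 2 := map_ofNat _ 2
    simp [h2]
  have hnorm : Algebra.norm ℚ (aeval pb.gen (derivative (minpoly ℚ pb.gen))) =
      Algebra.norm ℚ z ^ 2 * (2 ^ pb.dim * a) := by
    rw [hderiv, map_mul, map_mul, Algebra.norm_algebraMap, pb.finrank, ← ha,
      ← Algebra.norm_norm (S := F), Algebra.norm_algebraMap, hrank, map_pow, eq_intCast]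
  have h1 := pb.discr_minpoly hP hmin
  rw [Algebra.discr_powerBasis_eq_norm, hnorm, hdisc] at h1
  have h2 := Algebra.discr_powerBasis_eq_norm ℚ (pb := pbF)
  rw [← hd, ← hz, eq_intCast] at h2
  have h3 : Algebra.norm ℚ z ^ 2 = (d : ℚ) ^ 2 := by
    rw [h2, mul_pow, ← pow_mul, mul_comm _ 2, pow_mul, neg_one_sq, one_pow, one_mul]
  rw [h3] at h1
  have h4 : (k : ℚ) ^ 2 = (d : ℚ) ^ 2 *
      ((-1) ^ (Module.finrank ℚ K * (Module.finrank ℚ K - 1) / 2) * a) := by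
    have h20 : (2 : ℚ) ^ pb.dim ≠ 0 := by positivity
    apply mul_left_cancel₀ h20
    push_cast at h1
    rw [h1]; ring
  refine ⟨d, hk.squarefree_of_dvd ?_, by rw [← hd, eq_intCast]⟩
  rw [← Int.pow_dvd_pow_iff two_ne_zero]
  exact ⟨(-1) ^ (Module.finrank ℚ K * (Module.finrank ℚ K - 1) / 2) * a, by exact_mod_cast h4⟩

end DiscriminantOfSquare

/-! ### The cyclic module of a symmetric matrix and its walk form -/

section CyclicModel

open Polynomial Matrix

variable {K : Type*} [Field K] [NumberField K] (pb : PowerBasis ℚ K)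
variable {V : Type*} [Fintype V] [DecidableEq V]

/-- The linear form `f(α) ↦ 1ᵀ f(A) 1` on the field `K = ℚ(α)`, for a matrix `A` annihilated by the
minimal polynomial of `α`; its value at `α ^ k` is a weighted count of walks of length `k`. -/
noncomputable def Matrix.walkForm (A : Matrix V V ℚ) (h : aeval A (minpoly ℚ pb.gen) = 0) :
    K →ₗ[ℚ] ℚ :=
  (dotProductBilin ℚ ℚ (1 : V → ℚ)) ∘ₗ
    (Matrix.mulVecBilin ℚ ℚ).flip (1 : V → ℚ) ∘ₗ (pb.lift A h).toLinearMap

theorem Matrix.walkForm_apply (A : Matrix V V ℚ) (h : aeval A (minpoly ℚ pb.gen) = 0) (x : K) :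
    A.walkForm pb h x = 1 ⬝ᵥ (pb.lift A h x *ᵥ 1) := rfl

theorem PowerBasis.lift_transpose {A : Matrix V V ℚ} (h : aeval A (minpoly ℚ pb.gen) = 0)
    (hA : A.transpose = A) (x : K) : (pb.lift A h x).transpose = pb.lift A h x := by
  obtain ⟨p, rfl⟩ := pb.exists_eq_aeval' x
  rw [PowerBasis.lift_aeval]
  induction p using Polynomial.induction_on' with
  | add p q hp hq => simp [hp, hq]
  | monomial n a => simp [aeval_monomial, Matrix.transpose_pow, hA, ← Algebra.smul_def]

/-- When the characteristic polynomial of `A` is irreducible, the all-one vector is cyclic for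
`A`, and evaluating at it identifies `K` with `ℚ^V`. The standard scalar product of `ℚ^V` becomes
the form `(x, y) ↦ t (x * y)` with `t` the walk form. -/
theorem Matrix.exists_cyclic_equiv {A : Matrix V V ℚ} (h : aeval A (minpoly ℚ pb.gen) = 0)
    (hcard : pb.dim = Fintype.card V) (hA : A.transpose = A) :
    ∃ ev : K ≃ₗ[ℚ] (V → ℚ), (∀ x, ev (pb.gen * x) = A *ᵥ ev x) ∧
      ∀ x y, ev x ⬝ᵥ ev y = A.walkForm pb h (x * y) := by
  have : Nonempty V := Fintype.card_pos_iff.1 (hcard ▸ pb.dim_pos)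
  let f : K →ₗ[ℚ] (V → ℚ) :=
    (Matrix.mulVecBilin ℚ ℚ).flip (1 : V → ℚ) ∘ₗ (pb.lift A h).toLinearMap
  have hf : ∀ x, f x = pb.lift A h x *ᵥ 1 := fun x => rfl
  have hinj : Function.Injective f := by
    rw [injective_iff_map_eq_zero]
    intro x hx
    by_contra hx0
    have : pb.lift A h x⁻¹ *ᵥ f x = 1 := by
      rw [hf, Matrix.mulVec_mulVec, ← map_mul, inv_mul_cancel₀ hx0, map_one, Matrix.one_mulVec]
    rw [hx, Matrix.mulVec_zero] at this
    exact zero_ne_one this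
  have hdim : Module.finrank ℚ K = Module.finrank ℚ (V → ℚ) := by
    rw [pb.finrank, hcard, Module.finrank_fintype_fun_eq_card]
  refine ⟨LinearEquiv.ofInjectiveOfFinrankEq f hinj hdim, fun x => ?_, fun x y => ?_⟩
  · change f _ = A *ᵥ f _
    rw [hf, hf, map_mul, PowerBasis.lift_gen, Matrix.mulVec_mulVec]
  · change f _ ⬝ᵥ f _ = _
    rw [hf, hf, Matrix.walkForm_apply, map_mul, ← Matrix.mulVec_mulVec,
      Matrix.dotProduct_mulVec 1, ← Matrix.mulVec_transpose, pb.lift_transpose h hA]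

theorem PowerBasis.algebraMap_sub_gen_ne_zero (hdim : pb.dim ≠ 1) (y : ℚ) :
    algebraMap ℚ K y - pb.gen ≠ 0 := by
  intro hy
  have h1 : pb.gen = algebraMap ℚ K y := (sub_eq_zero.1 hy).symm
  apply hdim
  rw [← pb.natDegree_minpoly, h1, minpoly.eq_X_sub_C, natDegree_X_sub_C]

/-- A linear form on `K = ℚ(α)` is determined by its values at all `(y - α)⁻¹` with `y` rational.
Indeed `φ(y) (y - α)⁻¹` is a polynomial in `y` (with `φ` the minimal polynomial of `α`) whose
coefficients span `K`. -/
theorem PowerBasis.linearMap_ext_inv (hdim : pb.dim ≠ 1) {t t' : K →ₗ[ℚ] ℚ}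
    (h : ∀ y : ℚ, t (algebraMap ℚ K y - pb.gen)⁻¹ = t' (algebraMap ℚ K y - pb.gen)⁻¹) :
    t = t' := by
  have hint : IsIntegral ℚ pb.gen := pb.isIntegral_gen
  set q := minpolyDiv ℚ pb.gen with hq
  have hspec : q * (X - C pb.gen) = (minpoly ℚ pb.gen).map (algebraMap ℚ K) := minpolyDiv_spec _ _
  have heval : ∀ y : ℚ, q.eval (algebraMap ℚ _ y) =
      (minpoly ℚ pb.gen).eval y • (algebraMap ℚ K y - pb.gen)⁻¹ := by
    intro y
    have := congrArg (eval (algebraMap ℚ K y)) hspec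
    rw [eval_mul, eval_sub, eval_X, eval_C, eval_map_algebraMap, aeval_algebraMap_apply] at this
    rw [Algebra.smul_def, eq_mul_inv_iff_mul_eq₀ (pb.algebraMap_sub_gen_ne_zero hdim y), this]
    simp
  have hcoeff : ∀ s : K →ₗ[ℚ] ℚ, ∀ y : ℚ,
      (∑ i ∈ Finset.range (q.natDegree + 1), C (s (q.coeff i)) * X ^ i : ℚ[X]).eval y =
        s (q.eval (algebraMap ℚ _ y)) := by
    intro s y
    rw [eval_finsetSum, eval_eq_sum_range, map_sum]
    refine Finset.sum_congr rfl fun i _ => ?_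
    rw [← map_pow, mul_comm (q.coeff i), ← Algebra.smul_def, map_smul, eval_mul, eval_C, eval_pow,
      eval_X, smul_eq_mul, mul_comm]
  have hpoly : (∑ i ∈ Finset.range (q.natDegree + 1), C (t (q.coeff i)) * X ^ i : ℚ[X]) =
      ∑ i ∈ Finset.range (q.natDegree + 1), C (t' (q.coeff i)) * X ^ i := by
    refine Polynomial.funext fun y => ?_
    rw [hcoeff, hcoeff, heval, map_smul, map_smul, h]
  have hc : ∀ i, t (q.coeff i) = t' (q.coeff i) := by
    intro i
    by_cases hi : i < q.natDegree + 1
    · have := congrArg (fun p => coeff p i) hpoly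
      simpa [finsetSum_coeff, coeff_X_pow, Nat.lt_succ_iff.1 hi] using this
    · rw [coeff_eq_zero_of_natDegree_lt (by omega), map_zero, map_zero]
  have hspan : Submodule.span ℚ (Set.range q.coeff) = ⊤ := by
    rw [hq, span_coeff_minpolyDiv hint, ← Algebra.top_toSubmodule, pb.adjoin_gen_eq_top]
  exact LinearMap.ext_on_range hspan hc

/-- The characteristic polynomial of `J - I - A` in terms of the resolvent of `A`, by the matrix
determinant lemma for the rank-one matrix `J`. -/
theorem Matrix.eval_charpoly_compl {A : Matrix V V ℚ} (hA : A.charpoly = minpoly ℚ pb.gen)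
    (h : aeval A (minpoly ℚ pb.gen) = 0) (hdim : pb.dim ≠ 1) (y : ℚ) :
    (Matrix.of (fun _ _ => 1) - 1 - A).charpoly.eval (-y - 1) =
      (-1) ^ Fintype.card V * ((minpoly ℚ pb.gen).eval y *
        (1 + A.walkForm pb h (algebraMap ℚ K y - pb.gen)⁻¹)) := by
  have hdet : (Matrix.scalar V y - A).det = (minpoly ℚ pb.gen).eval y := by
    rw [← hA, Matrix.eval_charpoly]
  have h0 := pb.algebraMap_sub_gen_ne_zero hdim y
  have hsub : Matrix.scalar V y - A = pb.lift A h (algebraMap ℚ K y - pb.gen) := by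
    rw [map_sub, PowerBasis.lift_gen, AlgHom.commutes]; rfl
  have hinv : pb.lift A h (algebraMap ℚ K y - pb.gen)⁻¹ = (Matrix.scalar V y - A)⁻¹ := by
    refine (Matrix.inv_eq_left_inv ?_).symm
    rw [hsub, ← map_mul, inv_mul_cancel₀ h0, map_one]
  have hunit : IsUnit (Matrix.scalar V y - A).det := by
    rw [← Matrix.isUnit_iff_isUnit_det, hsub]
    exact h0.isUnit.map _
  rw [Matrix.eval_charpoly, Matrix.walkForm_apply, hinv]
  have h1 : Matrix.scalar V (-y - 1) - (Matrix.of (fun _ _ => 1) - 1 - A) =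
      -((Matrix.scalar V y - A) +
        (replicateCol Unit 1 : Matrix V Unit ℚ) * (replicateRow Unit 1 : Matrix Unit V ℚ)) := by
    ext i j
    by_cases hij : i = j <;> simp [hij, Matrix.mul_apply] <;> ring
  rw [h1, Matrix.det_neg, Matrix.det_add_replicateCol_mul_replicateRow hunit, hdet,
    Matrix.det_unique]
  congr 3
  rw [Matrix.add_apply, Matrix.one_apply_eq, Matrix.mul_assoc]
  simp [Matrix.mul_apply, dotProduct, mulVec]

/-- Generalized cospectral matrices have the same walk form. -/
theorem Matrix.walkForm_eq {W : Type*} [Fintype W] [DecidableEq W] {A : Matrix V V ℚ}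
    {B : Matrix W W ℚ} (hA : A.charpoly = minpoly ℚ pb.gen) (hB : B.charpoly = minpoly ℚ pb.gen)
    (hA0 : aeval A (minpoly ℚ pb.gen) = 0) (hB0 : aeval B (minpoly ℚ pb.gen) = 0)
    (hdim : pb.dim ≠ 1)
    (hcompl : (Matrix.of (fun _ _ => 1) - 1 - A).charpoly =
      (Matrix.of (fun _ _ => 1) - 1 - B).charpoly) :
    A.walkForm pb hA0 = B.walkForm pb hB0 := by
  have hcard : Fintype.card V = Fintype.card W := by
    rw [← A.charpoly_natDegree_eq_dim, ← B.charpoly_natDegree_eq_dim, hA, hB]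
  refine pb.linearMap_ext_inv hdim fun y => ?_
  have hy : (minpoly ℚ pb.gen).eval y ≠ 0 := by
    intro h0
    apply hdim
    rw [← pb.natDegree_minpoly]
    exact natDegree_eq_of_degree_eq_some
      (degree_eq_one_of_irreducible_of_root (minpoly.irreducible pb.isIntegral_gen) h0)
  have h := congrArg (eval (-y - 1)) hcompl
  rw [Matrix.eval_charpoly_compl pb hA hA0 hdim, Matrix.eval_charpoly_compl pb hB hB0 hdim,
    hcard] at h
  simpa [hy] using h

end CyclicModel

/-! ### Graded self-dual lattices -/

section SelfDual

open Polynomial IntermediateField NumberField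

variable {K : Type*} [Field K] [NumberField K] (pb : PowerBasis ℚ K)

/-- A finitely generated `ℤ[α]`-submodule of `K = ℚ(α)` that equals its own dual for the bilinear
form `(x, y) ↦ t (x * y)`. -/
structure PowerBasis.IsSelfDual (t : K →ₗ[ℚ] ℚ) (L : Submodule ℤ K) : Prop where
  fg : L.FG
  gen_mul_mem : ∀ x ∈ L, pb.gen * x ∈ L
  mem_iff : ∀ x, x ∈ L ↔ ∀ y ∈ L, ∃ k : ℤ, t (x * y) = k

/-- An involutive isometry of the form `(x, y) ↦ t (x * y)` on `K = ℚ(α)` anticommuting with the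
multiplication by `α`. Its eigenspaces for `1` and `-1` are swapped by `α`, hence grade `K`. -/
structure PowerBasis.IsGrading (t : K →ₗ[ℚ] ℚ) (δ : K →ₗ[ℚ] K) : Prop where
  map_gen_mul : ∀ x, δ (pb.gen * x) = -(pb.gen * δ x)
  isometry : ∀ x y, t (δ x * δ y) = t (x * y)
  involutive : ∀ x, δ (δ x) = x

variable {pb} {t : K →ₗ[ℚ] ℚ} {δ : K →ₗ[ℚ] K}

theorem PowerBasis.IsGrading.neg (hδ : pb.IsGrading t δ) : pb.IsGrading t (-δ) :=
  ⟨fun y => by simp [hδ.map_gen_mul], fun y z => by simp [hδ.isometry],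
    fun y => by simp [hδ.involutive]⟩

/-- A grading is linear over `ℚ(α ^ 2)`. -/
theorem PowerBasis.IsGrading.map_adjoin_sq_mul (hδ : pb.IsGrading t δ)
    {f : K} (hf : f ∈ ℚ⟮pb.gen ^ 2⟯) : ∀ x, δ (f * x) = f * δ x := by
  induction hf using IntermediateField.adjoin_induction with
  | mem y hy =>
    rw [Set.mem_singleton_iff] at hy
    intro x
    rw [hy, sq, mul_assoc, hδ.map_gen_mul, hδ.map_gen_mul, mul_neg, neg_neg, mul_assoc]
  | algebraMap q => intro x; rw [← Algebra.smul_def, map_smul, Algebra.smul_def]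
  | add y z _ _ hy hz => intro x; rw [add_mul, map_add, hy, hz, add_mul]
  | inv y _ hy =>
    intro x
    rcases eq_or_ne y 0 with rfl | h0
    · simp
    · rw [eq_inv_mul_iff_mul_eq₀ h0, ← hy, mul_inv_cancel_left₀ h0]
  | mul y z _ _ hy hz => intro x; rw [mul_assoc, hy, hz, mul_assoc]

variable (pb) in
theorem PowerBasis.exists_add_gen_mul (u : K) :
    ∃ a ∈ ℚ⟮pb.gen ^ 2⟯, ∃ b ∈ ℚ⟮pb.gen ^ 2⟯, u = a + pb.gen * b := by
  obtain ⟨p, rfl⟩ := pb.exists_eq_aeval' u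
  induction p using Polynomial.induction_on with
  | C a => exact ⟨algebraMap ℚ K a, IntermediateField.algebraMap_mem _ a, 0, zero_mem _, by simp⟩
  | add p q hp hq =>
    obtain ⟨a, ha, b, hb, h⟩ := hp
    obtain ⟨c, hc, d, hd, h'⟩ := hq
    exact ⟨a + c, add_mem ha hc, b + d, add_mem hb hd, by rw [map_add, h, h']; ring⟩
  | monomial n a h =>
    obtain ⟨c, hc, d, hd, h⟩ := h
    refine ⟨pb.gen ^ 2 * d, mul_mem (mem_adjoin_simple_self ℚ _) hd, c, hc, ?_⟩
    rw [pow_succ, ← mul_assoc, map_mul, h, aeval_X]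
    ring

/-- The fixed space of a grading is a line over `ℚ(α ^ 2)`, spanned by any of its nonzero vectors.
-/
theorem PowerBasis.IsGrading.mem_of_fixed (hδ : pb.IsGrading t δ)
    (hgen : pb.gen ≠ 0) {w u : K} (hw0 : w ≠ 0) (hw : δ w = w) (hu : δ (u * w) = u * w) :
    u ∈ ℚ⟮pb.gen ^ 2⟯ := by
  obtain ⟨a, ha, b, hb, rfl⟩ := pb.exists_add_gen_mul u
  have h : δ ((a + pb.gen * b) * w) = (a - pb.gen * b) * w := by
    rw [add_mul, map_add, mul_assoc, hδ.map_gen_mul, hδ.map_adjoin_sq_mul ha, hδ.map_adjoin_sq_mul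
      hb, hw]
    ring
  rw [h] at hu
  have h2 : 2 * (pb.gen * b) = 0 := by linear_combination -(mul_right_cancel₀ hw0 hu)
  have hb0 : b = 0 := by simpa [hgen] using h2
  simpa [hb0] using ha

/-- Two self-dual lattices stable under the projection to the fixed space of the same grading have
the same fixed vectors, provided that `ℤ[α ^ 2]` is the ring of integers of `F = ℚ(α ^ 2)`. Dividing
by a fixed vector `w` turns the fixed parts of the lattices into fractional ideals of `F` that are
self-dual for the same form. -/
theorem PowerBasis.IsSelfDual.mem_of_fixed (hδ : pb.IsGrading t δ) (hgen : pb.gen ≠ 0)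
    (hmax : ∀ z : 𝓞 ℚ⟮pb.gen ^ 2⟯,
      (z : ℚ⟮pb.gen ^ 2⟯) ∈ Algebra.adjoin ℤ {AdjoinSimple.gen ℚ (pb.gen ^ 2)})
    {L L' : Submodule ℤ K} (hL : pb.IsSelfDual t L) (hL' : pb.IsSelfDual t L')
    (hgr : ∀ x ∈ L, (1 / 2 : ℚ) • (x + δ x) ∈ L) (hgr' : ∀ x ∈ L', (1 / 2 : ℚ) • (x + δ x) ∈ L')
    {w : K} (hw : δ w = w) (hwL : w ∈ L) : w ∈ L' := by
  rcases eq_or_ne w 0 with rfl | hw0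
  · exact zero_mem _
  set F := ℚ⟮pb.gen ^ 2⟯ with hF
  let mulw : F →ₗ[ℤ] K :=
    { toFun := fun f => f * w
      map_add' := fun f g => by push_cast; ring
      map_smul' := fun n f => by simp [mul_assoc] }
  have hmulw : ∀ f : F, mulw f = f * w := fun f => rfl
  have hinj : Function.Injective mulw := fun f g h => Subtype.ext (mul_right_cancel₀ hw0 h)
  let τ : F →+ ℚ :=
    { toFun := fun f => t (f * w ^ 2)
      map_zero' := by simp
      map_add' := fun f g => by push_cast; rw [add_mul, map_add] }
  have hτ : ∀ f g : F, τ (f * g) = t (mulw f * mulw g) := fun f g => by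
    change t _ = t _
    rw [hmulw, hmulw]; push_cast; congr 1; ring
  -- the fractional ideal attached to a lattice
  have key : ∀ N : Submodule ℤ K, pb.IsSelfDual t N → (∀ x ∈ N, (1 / 2 : ℚ) • (x + δ x) ∈ N) →
      ∃ I : Submodule (𝓞 F) F, I.FG ∧ (∀ f, f ∈ I ↔ mulw f ∈ N) ∧
        ∀ f, f ∈ I ↔ ∀ g ∈ I, ∃ k : ℤ, τ (f * g) = k := by
    intro N hN hNgr
    have hstab : ∀ f ∈ Algebra.adjoin ℤ {AdjoinSimple.gen ℚ (pb.gen ^ 2)}, ∀ x ∈ N,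
        (f : K) * x ∈ N := by
      intro f hf
      induction hf using Algebra.adjoin_induction with
      | mem y hy =>
        rw [Set.mem_singleton_iff] at hy
        intro x hx
        rw [hy, AdjoinSimple.coe_gen, sq, mul_assoc]
        exact hN.gen_mul_mem _ (hN.gen_mul_mem _ hx)
      | algebraMap n =>
        intro x hx
        have : ((algebraMap ℤ F n : F) : K) * x = n • x := by simp
        rw [this]
        exact N.smul_mem n hx
      | add y z _ _ hy hz =>
        intro x hx
        push_cast
        rw [add_mul]
        exact add_mem (hy x hx) (hz x hx)
      | mul y z _ _ hy hz =>
        intro x hx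
        push_cast
        rw [mul_assoc]
        exact hy _ (hz x hx)
    let I : Submodule (𝓞 F) F :=
      { carrier := {f | mulw f ∈ N}
        add_mem' := fun {f g} hf hg => by
          simp only [Set.mem_ofPred_eq, map_add] at *
          exact add_mem hf hg
        zero_mem' := by simp
        smul_mem' := fun z f hf => by
          have h : mulw (z • f) = ((z : F) : K) * mulw f := by
            rw [hmulw, hmulw, Algebra.smul_def, ← mul_assoc]; rfl
          rw [Set.mem_ofPred_eq, h]
          exact hstab _ (hmax z) _ hf }
    have hI : ∀ f, f ∈ I ↔ mulw f ∈ N := fun f => Iff.rfl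
    refine ⟨I, ?_, hI, fun f => ⟨fun hf g hg => ?_, fun hf => ?_⟩⟩
    · refine Submodule.FG.of_restrictScalars ℤ ?_
      refine Submodule.fg_of_fg_map_injective mulw hinj (hN.fg.of_le ?_)
      rintro _ ⟨f, hf, rfl⟩
      exact hf
    · rw [hτ]
      exact (hN.mem_iff _).1 hf _ hg
    · rw [hI, hN.mem_iff]
      intro y hy
      -- only the fixed part of `y` pairs nontrivially with the fixed vector `f * w`
      set y₁ := (1 / 2 : ℚ) • (y + δ y) with hy₁
      have hy₁fix : δ y₁ = y₁ := by rw [hy₁, map_smul, map_add, hδ.involutive, add_comm]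
      have hu : y₁ / w ∈ F := by
        refine hδ.mem_of_fixed hgen hw0 hw ?_
        rw [div_mul_cancel₀ _ hw0, hy₁fix]
      have hmul : mulw ⟨y₁ / w, hu⟩ = y₁ := div_mul_cancel₀ _ hw0
      obtain ⟨k, hk⟩ := hf ⟨y₁ / w, hu⟩ (by rw [hI, hmul]; exact hNgr y hy)
      refine ⟨k, ?_⟩
      rw [← hk, hτ, hmul]
      have hfix : δ (mulw f) = mulw f := by rw [hmulw, hδ.map_adjoin_sq_mul f.2, hw]
      have h1 : t (mulw f * δ y) = t (mulw f * y) := by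
        rw [← hδ.isometry (mulw f) y, hfix]
      rw [hy₁, mul_smul_comm, map_smul, mul_add, map_add, h1, smul_eq_mul]
      ring
  obtain ⟨I, hIfg, hI, hId⟩ := key L hL hgr
  obtain ⟨J, hJfg, hJ, hJd⟩ := key L' hL' hgr'
  have h1 : mulw 1 = w := by rw [hmulw]; simp
  rw [← h1, ← hJ]
  refine Submodule.le_of_self_dual τ hIfg hJfg hId hJd ?_
  rwa [hI, h1]

theorem PowerBasis.IsGrading.gen_notMem (hδ : pb.IsGrading t δ) (hgen : pb.gen ≠ 0) :
    pb.gen ∉ ℚ⟮pb.gen ^ 2⟯ := by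
  intro h
  have h1 := (hδ.map_adjoin_sq_mul h 1).symm.trans (hδ.map_gen_mul 1)
  have h2 : 2 * (pb.gen * δ 1) = 0 := by linear_combination h1
  have h3 : δ 1 = 0 := by simpa [hgen] using h2
  have h4 := hδ.involutive 1
  rw [h3, map_zero] at h4
  exact zero_ne_one h4

/-- The grading is determined by the form up to sign. -/
theorem PowerBasis.IsGrading.eq_or_eq_neg {δ' : K →ₗ[ℚ] K} (hδ : pb.IsGrading t δ)
    (hδ' : pb.IsGrading t δ') (hnd : ∀ x, (∀ y, t (x * y) = 0) → x = 0) : δ' = δ ∨ δ' = -δ := by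
  -- `δ ∘ δ'` commutes with `α`, so it is the multiplication by a field element `u`
  have hlin : ∀ x, δ (δ' x) = x * δ (δ' 1) := by
    intro x
    obtain ⟨p, rfl⟩ := pb.exists_eq_aeval' x
    induction p using Polynomial.induction_on with
    | C a => rw [aeval_C, ← Algebra.smul_def, Algebra.algebraMap_eq_smul_one, map_smul, map_smul]
    | add p q hp hq => rw [map_add, map_add, map_add, hp, hq, add_mul]
    | monomial n a h =>
      rw [pow_succ, ← mul_assoc, map_mul, aeval_X, mul_comm _ pb.gen, hδ'.map_gen_mul, map_neg,
        hδ.map_gen_mul, neg_neg, h, mul_assoc]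
  set u := δ (δ' 1)
  have hu : u ^ 2 - 1 = 0 := hnd _ fun y => by
    have h1 := (hδ.isometry (δ' y) (δ' 1)).trans (hδ'.isometry y 1)
    rw [hlin, hlin 1, mul_one, one_mul] at h1
    rw [show (u ^ 2 - 1) * y = y * u * u - y by ring, map_sub, h1, sub_self]
  have hδ'u : ∀ x, δ' x = δ (x * u) := fun x => by rw [← hlin, hδ.involutive]
  rcases (eq_or_eq_neg_of_sq_eq_sq u 1 (by rw [one_pow]; exact sub_eq_zero.1 hu)) with h | h
  · left
    ext x
    rw [hδ'u, h, mul_one]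
  · right
    ext x
    rw [hδ'u, h, mul_neg_one, map_neg, LinearMap.neg_apply]

/-- Self-dual lattices graded by the same `δ` coincide: compare their fixed vectors under `δ` and
under `-δ`. -/
theorem PowerBasis.IsSelfDual.le (hδ : pb.IsGrading t δ) (hgen : pb.gen ≠ 0)
    (hmax : ∀ z : 𝓞 ℚ⟮pb.gen ^ 2⟯,
      (z : ℚ⟮pb.gen ^ 2⟯) ∈ Algebra.adjoin ℤ {AdjoinSimple.gen ℚ (pb.gen ^ 2)})
    {L L' : Submodule ℤ K} (hL : pb.IsSelfDual t L) (hL' : pb.IsSelfDual t L')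
    (hgr : ∀ x ∈ L, (1 / 2 : ℚ) • (x + δ x) ∈ L) (hgr' : ∀ x ∈ L', (1 / 2 : ℚ) • (x + δ x) ∈ L') :
    L ≤ L' := by
  intro x hx
  have hsplit : ∀ y : K, (1 / 2 : ℚ) • (y + (-δ) y) = y - (1 / 2 : ℚ) • (y + δ y) := by
    intro y
    rw [LinearMap.neg_apply]
    module
  have hp : (1 / 2 : ℚ) • (x + δ x) ∈ L' :=
    hL.mem_of_fixed hδ hgen hmax hL' hgr hgr'
      (by rw [map_smul, map_add, hδ.involutive, add_comm]) (hgr x hx)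
  have hm : (1 / 2 : ℚ) • (x + (-δ) x) ∈ L' := by
    refine hL.mem_of_fixed hδ.neg hgen hmax hL' ?_ ?_ (by simp [hδ.involutive, add_comm]) ?_
    · intro y hy
      rw [hsplit]
      exact sub_mem hy (hgr y hy)
    · intro y hy
      rw [hsplit]
      exact sub_mem hy (hgr' y hy)
    · rw [hsplit]
      exact sub_mem hx (hgr x hx)
  have := add_mem hp hm
  rwa [hsplit, add_sub_cancel] at this

end SelfDual

/-! ### Integral vectors and signed permutations -/

section IntegralLattice

open Matrix

variable {K : Type*} [Field K] [NumberField K] {pb : PowerBasis ℚ K} {t : K →ₗ[ℚ] ℚ}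
variable {V : Type*}

/-- The pullback of `ℤ^V` to `K` along a linear equivalence `ev : K ≃ ℚ^V`. -/
def integralLattice (ev : K ≃ₗ[ℚ] (V → ℚ)) : Submodule ℤ K where
  carrier := {x | ∃ z : V → ℤ, ev x = fun v => (z v : ℚ)}
  add_mem' := by
    rintro x y ⟨z, hz⟩ ⟨z', hz'⟩
    exact ⟨z + z', by rw [map_add, hz, hz']; ext v; simp⟩
  zero_mem' := ⟨0, by ext; simp⟩
  smul_mem' := by
    rintro n x ⟨z, hz⟩
    exact ⟨n • z, by rw [map_zsmul, hz]; ext v; simp⟩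

variable {ev : K ≃ₗ[ℚ] (V → ℚ)}

theorem mem_integralLattice {x : K} :
    x ∈ integralLattice ev ↔ ∃ z : V → ℤ, ev x = fun v => (z v : ℚ) := Iff.rfl

theorem integralLattice_isSelfDual [Fintype V] [DecidableEq V] {A : Matrix V V ℤ}
    (hgen : ∀ x, ev (pb.gen * x) = A.map (Int.castRingHom ℚ) *ᵥ ev x)
    (hform : ∀ x y, ev x ⬝ᵥ ev y = t (x * y)) : pb.IsSelfDual t (integralLattice ev) where
  fg := by
    let f : (V → ℤ) →ₗ[ℤ] K :=
      (ev.symm.toLinearMap.restrictScalars ℤ) ∘ₗ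
        LinearMap.compLeft (Algebra.linearMap ℤ ℚ) V
    have : integralLattice ev = LinearMap.range f := by
      ext x
      rw [mem_integralLattice, LinearMap.mem_range]
      refine exists_congr fun z => ?_
      rw [← LinearEquiv.eq_symm_apply]
      exact eq_comm
    rw [this]
    exact (LinearMap.range_eq_map f) ▸ Module.Finite.fg_top.map f
  gen_mul_mem := by
    rintro x ⟨z, hz⟩
    refine ⟨A *ᵥ z, ?_⟩
    rw [hgen, hz]
    ext v
    simp [mulVec, dotProduct]
  mem_iff := by
    intro x
    constructor
    · rintro ⟨z, hz⟩ y ⟨z', hz'⟩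
      refine ⟨z ⬝ᵥ z', ?_⟩
      rw [← hform, hz, hz']
      simp [dotProduct]
    · intro h
      have hv : ∀ v, ∃ k : ℤ, ev x v = k := by
        intro v
        obtain ⟨k, hk⟩ := h (ev.symm (Pi.single v 1))
          ⟨Pi.single v 1, by
            rw [LinearEquiv.apply_symm_apply]
            ext u
            rcases eq_or_ne u v with rfl | huv <;> simp [*]⟩
        refine ⟨k, ?_⟩
        rw [← hk, ← hform, LinearEquiv.apply_symm_apply, dotProduct_single, mul_one]
      choose z hz using hv
      exact ⟨z, funext hz⟩

/-- The endomorphism of `K` acting on the coordinates in `ℚ^V` through the signs `d`. -/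
noncomputable def signChange (ev : K ≃ₗ[ℚ] (V → ℚ)) (d : V → ℤˣ) : K →ₗ[ℚ] K :=
  ev.symm.toLinearMap ∘ₗ
    LinearMap.pi (fun v => ((d v : ℤ) : ℚ) • LinearMap.proj v) ∘ₗ ev.toLinearMap

theorem apply_signChange (d : V → ℤˣ) (x : K) (v : V) :
    ev (signChange ev d x) v = ((d v : ℤ) : ℚ) * ev x v := by
  simp [signChange]

theorem Int.units_cast_rat_mul_self (s : ℤˣ) : ((s : ℤ) : ℚ) * ((s : ℤ) : ℚ) = 1 := by
  rw [← Int.cast_mul, ← Units.val_mul, Int.units_mul_self]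
  simp

/-- Signs of the vertices that anticommute with `A` grade `K`. -/
theorem signChange_isGrading [Fintype V] {A : Matrix V V ℤ}
    (hgen : ∀ x, ev (pb.gen * x) = A.map (Int.castRingHom ℚ) *ᵥ ev x)
    (hform : ∀ x y, ev x ⬝ᵥ ev y = t (x * y)) {d : V → ℤˣ}
    (hd : ∀ u v, (d u : ℤ) * A u v = -(A u v * d v)) : pb.IsGrading t (signChange ev d) where
  map_gen_mul x := by
    apply ev.injective
    ext v
    rw [apply_signChange, map_neg, hgen, hgen, Pi.neg_apply]
    simp only [mulVec, dotProduct, Finset.mul_sum, ← Finset.sum_neg_distrib]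
    refine Finset.sum_congr rfl fun u _ => ?_
    have h : ((d v : ℤ) : ℚ) * (A v u : ℚ) = -((A v u : ℚ) * ((d u : ℤ) : ℚ)) := by
      exact_mod_cast hd v u
    rw [apply_signChange, Matrix.map_apply, eq_intCast, ← mul_assoc, h]
    ring
  isometry x y := by
    rw [← hform, ← hform]
    refine Finset.sum_congr rfl fun v _ => ?_
    rw [apply_signChange, apply_signChange, mul_mul_mul_comm, Int.units_cast_rat_mul_self, one_mul]
  involutive x := by
    apply ev.injective
    ext v
    rw [apply_signChange, apply_signChange, ← mul_assoc, Int.units_cast_rat_mul_self, one_mul]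

theorem half_add_signChange_mem (d : V → ℤˣ) {x : K} (hx : x ∈ integralLattice ev) :
    (1 / 2 : ℚ) • (x + signChange ev d x) ∈ integralLattice ev := by
  obtain ⟨z, hz⟩ := hx
  refine ⟨fun v => if d v = 1 then z v else 0, ?_⟩
  ext v
  rw [map_smul, map_add, Pi.smul_apply, Pi.add_apply, apply_signChange, hz]
  rcases Int.units_eq_one_or (d v) with h | h <;> simp [h]
  ring

theorem exists_ne_zero_of_sum_sq_eq_one {W : Type*} [Fintype W] {z : W → ℤ}
    (hz : ∑ w, z w * z w = 1) : ∃ w, z w ≠ 0 ∧ ∀ w', w' ≠ w → z w' = 0 := by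
  classical
  obtain ⟨w, -, hw⟩ := Finset.exists_ne_zero_of_sum_ne_zero (hz ▸ one_ne_zero)
  have hw0 : z w ≠ 0 := fun h => hw (by simp [h])
  refine ⟨w, hw0, fun w' hw' => ?_⟩
  rw [← Finset.add_sum_erase _ _ (Finset.mem_univ w)] at hz
  have h1 : 0 < z w * z w := mul_self_pos.2 hw0
  have h2 : 0 ≤ ∑ x ∈ Finset.univ.erase w, z x * z x :=
    Finset.sum_nonneg fun x _ => mul_self_nonneg _
  have h3 : ∑ x ∈ Finset.univ.erase w, z x * z x = 0 := by omega
  rw [Finset.sum_eq_zero_iff_of_nonneg fun x _ => mul_self_nonneg _] at h3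
  exact mul_self_eq_zero.1 (h3 w' (Finset.mem_erase.2 ⟨hw', Finset.mem_univ _⟩))

/-- An integral matrix with orthonormal rows is a signed permutation matrix. -/
theorem Matrix.exists_equiv_of_mul_transpose_eq_one {V W : Type*} [Fintype V] [DecidableEq V]
    [Fintype W] (hcard : Fintype.card V = Fintype.card W)
    {Z : Matrix V W ℤ} (hZ : Z * Z.transpose = 1) :
    ∃ σ : V ≃ W, (∀ v, Z v (σ v) ≠ 0) ∧ ∀ v w, w ≠ σ v → Z v w = 0 := by
  have hentry : ∀ v u, ∑ w, Z v w * Z u w = (1 : Matrix V V ℤ) v u := fun v u => by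
    rw [← hZ]; rfl
  choose σ hσ hσ0 using fun v =>
    exists_ne_zero_of_sum_sq_eq_one (z := Z v) (by rw [hentry, Matrix.one_apply_eq])
  have hinj : Function.Injective σ := by
    intro v u hvu
    by_contra hne
    have h := hentry v u
    rw [Matrix.one_apply_ne hne, Finset.sum_eq_single (σ v)
      (fun w _ hw => by rw [hσ0 v w hw, zero_mul]) (by simp)] at h
    exact mul_ne_zero (hσ v) (hvu ▸ hσ u) h
  exact ⟨Equiv.ofBijective σ ((Fintype.bijective_iff_injective_and_card σ).2 ⟨hinj, hcard⟩),
    hσ, hσ0⟩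

/-- If the integral vectors of `ℚ^V` are integral in `ℚ^W`, the standard basis of `ℤ^V` is carried
to an orthonormal family in `ℤ^W`, that is to standard basis vectors up to sign. The matrices by
which `α` acts on both sides then have the same pattern of zeros. -/
theorem exists_equiv_of_integralLattice_le {K : Type*} [Field K] [NumberField K]
    {pb : PowerBasis ℚ K} {t : K →ₗ[ℚ] ℚ} {V W : Type*} [Fintype V] [DecidableEq V]
    [Fintype W] [DecidableEq W] (hcard : Fintype.card V = Fintype.card W)
    {A : Matrix V V ℤ} {B : Matrix W W ℤ}
    {ev : K ≃ₗ[ℚ] (V → ℚ)} {ev' : K ≃ₗ[ℚ] (W → ℚ)}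
    (hgen : ∀ x, ev (pb.gen * x) = A.map (Int.castRingHom ℚ) *ᵥ ev x)
    (hform : ∀ x y, ev x ⬝ᵥ ev y = t (x * y))
    (hgen' : ∀ x, ev' (pb.gen * x) = B.map (Int.castRingHom ℚ) *ᵥ ev' x)
    (hform' : ∀ x y, ev' x ⬝ᵥ ev' y = t (x * y))
    (hle : integralLattice ev ≤ integralLattice ev') :
    ∃ σ : V ≃ W, ∀ u v, A u v = 0 ↔ B (σ u) (σ v) = 0 := by
  let e : V → K := fun v => ev.symm (Pi.single v 1)
  have hev : ∀ v, ev (e v) = Pi.single v 1 := fun v => LinearEquiv.apply_symm_apply _ _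
  have hmem : ∀ v, e v ∈ integralLattice ev := fun v => ⟨Pi.single v 1, by
    rw [hev]
    ext u
    rcases eq_or_ne u v with rfl | huv <;> simp [*]⟩
  choose z hz using fun v => mem_integralLattice.1 (hle (hmem v))
  have hZ : Matrix.of z * (Matrix.of z).transpose = 1 := by
    ext v u
    have h := (hform (e v) (e u)).trans (hform' (e v) (e u)).symm
    rw [hev, hev, hz, hz, dotProduct_single, mul_one] at h
    rw [Matrix.mul_apply]
    have h' : ((∑ w, z v w * z u w : ℤ) : ℚ) = ((1 : Matrix V V ℤ) v u : ℤ) := by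
      push_cast
      rw [← dotProduct, ← h, Matrix.one_apply, Pi.single_apply]
      simp [eq_comm]
    exact_mod_cast h'
  obtain ⟨σ, hσ, hσ0⟩ := Matrix.exists_equiv_of_mul_transpose_eq_one hcard hZ
  refine ⟨σ, fun u v => ?_⟩
  have h := (hform (e u) (pb.gen * e v)).trans (hform' (e u) (pb.gen * e v)).symm
  rw [hgen, hgen', hev, hev, hz, hz] at h
  have h1 : Pi.single u 1 ⬝ᵥ (A.map (Int.castRingHom ℚ) *ᵥ Pi.single v 1) = (A u v : ℚ) := by
    simp
  have h2 : ∀ i, (B.map (Int.castRingHom ℚ) *ᵥ fun w => (z v w : ℚ)) i =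
      B i (σ v) * z v (σ v) := fun i => by
    rw [mulVec, dotProduct, Finset.sum_eq_single (σ v)]
    · simp
    · intro w _ hw
      have : z v w = 0 := hσ0 v w hw
      simp [this]
    · simp
  have h3 : (A u v : ℚ) = z u (σ u) * (B (σ u) (σ v) * z v (σ v)) := by
    rw [← h1, h, dotProduct, Finset.sum_eq_single (σ u), h2]
    · intro w _ hw
      have : z u w = 0 := hσ0 u w hw
      simp [this]
    · simp
  have h4 : A u v = z u (σ u) * (B (σ u) (σ v) * z v (σ v)) := by exact_mod_cast h3
  have hu : z u (σ u) ≠ 0 := hσ u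
  have hv : z v (σ v) ≠ 0 := hσ v
  rw [h4]
  simp [hu, hv]

end IntegralLattice

/-! ### Signed trees -/

theorem SignedGraph.adjMatrix_eq_zero_iff {V : Type*} (Γ : SignedGraph V) (u v : V) :
    Γ.adjMatrix u v = 0 ↔ ¬ Γ.underlying.Adj u v := by
  classical
  by_cases h : Γ.underlying.Adj u v <;> simp [SignedGraph.adjMatrix, h]

theorem SignedGraph.adjMatrix_transpose {V : Type*} (Γ : SignedGraph V) :
    Γ.adjMatrix.transpose = Γ.adjMatrix := by
  classical
  ext u v
  by_cases h : Γ.underlying.Adj u v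
  · simp [SignedGraph.adjMatrix, h, h.symm, Sym2.eq_swap]
  · have h' : ¬ Γ.underlying.Adj v u := fun h' => h h'.symm
    simp [SignedGraph.adjMatrix, h, h']

/-- The bipartition of a tree, as a change of sign of the vertices that turns the adjacency matrix
into its negative. -/
theorem SignedGraph.exists_anticommuting_signs {V : Type*} (Γ : SignedGraph V)
    (hΓ : Γ.underlying.IsTree) :
    ∃ d : V → ℤˣ, ∀ u v, (d u : ℤ) * Γ.adjMatrix u v = -(Γ.adjMatrix u v * d v) := by
  obtain ⟨d, hd⟩ := hΓ.exists_potential (fun _ _ => -1) fun _ _ => rfl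
  refine ⟨d, fun u v => ?_⟩
  by_cases h : Γ.underlying.Adj u v
  · have h1 : d u = -d v := by
      rw [← mul_one (d u), ← Int.units_mul_self (d v), ← mul_assoc, hd u v h, neg_one_mul]
    rw [h1, Units.val_neg]
    ring
  · rw [(Γ.adjMatrix_eq_zero_iff u v).2 h]
    simp

/-- All signatures of a tree are switching equivalent, hence cospectral. -/
theorem SignedGraph.charpoly_adjMatrix_of_isTree {V : Type*} [Fintype V] [DecidableEq V]
    (Γ : SignedGraph V) [DecidableRel Γ.underlying.Adj] (hΓ : Γ.underlying.IsTree) :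
    Γ.adjMatrix.charpoly = Γ.underlying.charPoly := by
  classical
  have key : ∃ d : V → ℤˣ, ∀ u v,
      Γ.adjMatrix u v = d u * Γ.underlying.adjMatrix ℤ u v * d v := by
    obtain ⟨d, hd⟩ := hΓ.exists_potential
      (fun u v => if h : Γ.underlying.Adj u v then Γ.sign ⟨s(u, v), h⟩ else 1) fun u v => by
        by_cases h : Γ.underlying.Adj u v
        · simp [h, h.symm, Sym2.eq_swap]
        · have h' : ¬ Γ.underlying.Adj v u := fun h' => h h'.symm
          simp [h, h']
    refine ⟨d, fun u v => ?_⟩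
    by_cases h : Γ.underlying.Adj u v
    · have := hd u v h
      simp only [h, dite_true] at this
      simp [SignedGraph.adjMatrix, h, ← this]
    · simp [SignedGraph.adjMatrix, h]
  obtain ⟨d, hd⟩ := key
  let D : Matrix V V ℤ := Matrix.diagonal fun v => (d v : ℤ)
  have hDD : D * D = 1 := by
    rw [Matrix.diagonal_mul_diagonal, ← Matrix.diagonal_one]
    congr 1
    ext v
    rw [← Units.val_mul, Int.units_mul_self, Units.val_one]
  have hconj : Γ.adjMatrix = D * Γ.underlying.adjMatrix ℤ * D := by
    ext u v
    rw [Matrix.mul_diagonal, Matrix.diagonal_mul, hd]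
  let M : (Matrix V V ℤ)ˣ := ⟨D, D, hDD, hDD⟩
  have hM := Matrix.charpoly_units_conj M (Γ.underlying.adjMatrix ℤ)
  rw [show (M : Matrix V V ℤ)⁻¹ = D from Matrix.inv_eq_right_inv hDD] at hM
  rw [SimpleGraph.charPoly, hconj, ← hM]

theorem Polynomial.exists_numberField_powerBasis {φ : Polynomial ℚ}
    (hφ : Irreducible φ) (hm : φ.Monic) :
    ∃ (K : Type) (_ : Field K) (_ : NumberField K) (pb : PowerBasis ℚ K),
      minpoly ℚ pb.gen = φ := by
  have : Fact (Irreducible φ) := ⟨hφ⟩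
  have hdim : FiniteDimensional ℚ (AdjoinRoot φ) := (AdjoinRoot.powerBasis hφ.ne_zero).finite
  have h : minpoly ℚ (AdjoinRoot.powerBasis hφ.ne_zero).gen = φ :=
    AdjoinRoot.minpoly_powerBasis_gen_of_monic hm
  have hchar : CharZero (AdjoinRoot φ) := algebraRat.charZero _
  exact ⟨AdjoinRoot φ, inferInstance, { to_charZero := hchar, to_finiteDimensional := hdim },
    AdjoinRoot.powerBasis hφ.ne_zero, h⟩

theorem Int.eq_two_pow_mul_sq_of_sqrt {D k : ℤ} {n : ℕ} (hk : k ≠ 0)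
    (h : (2 : ℝ) ^ (-(n : ℝ) / 2) * √(D : ℝ) = k) : D = 2 ^ n * k ^ 2 := by
  -- for negative `D` the real square root is `0`, which would force `k = 0`
  have hD : 0 ≤ (D : ℝ) := by
    by_contra hneg
    rw [Real.sqrt_eq_zero_of_nonpos (not_le.1 hneg).le, mul_zero] at h
    exact hk (by exact_mod_cast h.symm)
  have h2 : ((2 : ℝ) ^ (-(n : ℝ) / 2)) ^ 2 * 2 ^ n = 1 := by
    rw [← Real.rpow_natCast, ← Real.rpow_mul zero_le_two, ← Real.rpow_natCast,
      ← Real.rpow_add two_pos]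
    simp
  have h3 : (D : ℝ) = 2 ^ n * (k : ℝ) ^ 2 := by
    rw [← h, mul_pow, Real.sq_sqrt hD]
    linear_combination -(D : ℝ) * h2
  exact_mod_cast h3

open Polynomial Matrix IntermediateField in
theorem mainTheorem2 {V W : Type*} [Fintype V] [DecidableEq V] [Fintype W] [DecidableEq W]
    (T : SimpleGraph V) [DecidableRel T.Adj] (T' : SimpleGraph W) [DecidableRel T'.Adj]
    (hT : T.IsTree) (hT' : T'.IsTree)
    (hcospectral : T.charPoly = T'.charPoly)
    (hirreducible : Irreducible (T.charPoly.map (Int.castRingHom ℚ)))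
    (hnoniso : ¬ Nonempty (T ≃g T'))
    (hdisc : ∃ k : ℤ, (2 : ℝ) ^ (-(Fintype.card V : ℝ) / 2) * √(T.discriminant : ℝ) = (k : ℝ) ∧
      Odd k ∧ Squarefree k)
    (Γ : SignedGraph V) (Γ' : SignedGraph W)
    (hΓ : Γ.underlying = T) (hΓ' : Γ'.underlying = T') :
    ¬ Γ.GeneralizedCospectral Γ' := by
  rintro ⟨-, hcompl⟩
  subst hΓ hΓ'
  obtain ⟨k, hk, -, hsq⟩ := hdisc
  apply hnoniso
  have hmonic : Γ.underlying.charPoly.Monic := Matrix.charpoly_monic _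
  have hcardV : Γ.underlying.charPoly.natDegree = Fintype.card V :=
    Matrix.charpoly_natDegree_eq_dim _
  have hcard : Fintype.card V = Fintype.card W := by
    rw [← hcardV, hcospectral]
    exact Matrix.charpoly_natDegree_eq_dim _
  -- with a single vertex the two trees are isomorphic
  rcases eq_or_ne (Fintype.card V) 1 with h1 | h1
  · have : Subsingleton V := Fintype.card_le_one_iff_subsingleton.1 h1.le
    have : Subsingleton W := Fintype.card_le_one_iff_subsingleton.1 (hcard ▸ h1.le)
    exact ⟨⟨Fintype.equivOfCardEq hcard, fun {u v} => by
      rw [Subsingleton.elim u v]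
      simp⟩⟩
  obtain ⟨K, _, _, pb, hpb⟩ :=
    Polynomial.exists_numberField_powerBasis hirreducible (hmonic.map _)
  have hdimV : pb.dim = Fintype.card V := by
    rw [← pb.natDegree_minpoly, hpb, hmonic.natDegree_map, hcardV]
  have hdim1 : pb.dim ≠ 1 := hdimV ▸ h1
  have hgen0 : pb.gen ≠ 0 := fun h => pb.algebraMap_sub_gen_ne_zero hdim1 0 (by simp [h])
  set A := Γ.adjMatrix.map (Int.castRingHom ℚ) with hAdef
  set B := Γ'.adjMatrix.map (Int.castRingHom ℚ) with hBdef
  have hA : A.charpoly = minpoly ℚ pb.gen := by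
    rw [hAdef, Matrix.charpoly_map, Γ.charpoly_adjMatrix_of_isTree hT, hpb]
  have hB : B.charpoly = minpoly ℚ pb.gen := by
    rw [hBdef, Matrix.charpoly_map, Γ'.charpoly_adjMatrix_of_isTree hT', ← hcospectral, hpb]
  have hA0 : aeval A (minpoly ℚ pb.gen) = 0 := hA ▸ A.aeval_self_charpoly
  have hB0 : aeval B (minpoly ℚ pb.gen) = 0 := hB ▸ B.aeval_self_charpoly
  have hcomplA : Γ.complMatrix.map (Int.castRingHom ℚ) = Matrix.of (fun _ _ => 1) - 1 - A := by
    ext i j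
    simp [SignedGraph.complMatrix, hAdef, Matrix.one_apply, apply_ite]
  have hcomplB : Γ'.complMatrix.map (Int.castRingHom ℚ) = Matrix.of (fun _ _ => 1) - 1 - B := by
    ext i j
    simp [SignedGraph.complMatrix, hBdef, Matrix.one_apply, apply_ite]
  have hwalk : A.walkForm pb hA0 = B.walkForm pb hB0 :=
    Matrix.walkForm_eq pb hA hB hA0 hB0 hdim1 (by
      rw [← hcomplA, ← hcomplB, Matrix.charpoly_map, Matrix.charpoly_map, hcompl])
  obtain ⟨ev, hgen, hform⟩ := Matrix.exists_cyclic_equiv pb hA0 hdimV (by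
    rw [hAdef, ← Matrix.transpose_map, Γ.adjMatrix_transpose])
  obtain ⟨ev', hgen', hform'⟩ := Matrix.exists_cyclic_equiv pb hB0 (hdimV.trans hcard) (by
    rw [hBdef, ← Matrix.transpose_map, Γ'.adjMatrix_transpose])
  rw [← hwalk] at hform'
  obtain ⟨d, hd⟩ := Γ.exists_anticommuting_signs hT
  obtain ⟨d', hd'⟩ := Γ'.exists_anticommuting_signs hT'
  have hδ := signChange_isGrading hgen hform hd
  have hδ' := signChange_isGrading hgen' hform' hd'
  have hnd : ∀ x, (∀ y, A.walkForm pb hA0 (x * y) = 0) → x = 0 := by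
    intro x hx
    have := (hform x x).trans (hx x)
    rwa [dotProduct_self_eq_zero, LinearEquiv.map_eq_zero_iff] at this
  have hmem := hδ.gen_notMem hgen0
  obtain ⟨e, he, hde⟩ := pb.squarefree_discr_adjoin_sq hmem hmonic hpb.symm hsq (by
    rw [hdimV]
    exact Int.eq_two_pow_mul_sq_of_sqrt hsq.ne_zero hk)
  have hintα : IsIntegral ℤ pb.gen :=
    ⟨_, hmonic, by
      have := minpoly.aeval ℚ pb.gen
      rwa [hpb, aeval_def, eval₂_map, RingHom.ext_int ((algebraMap ℚ K).comp _) _] at this⟩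
  have hmax := NumberField.mem_adjoin_of_squarefree_discr _ (by
    rw [adjoin.powerBasis_gen, ← isIntegral_algebraMap_iff (algebraMap ℚ⟮pb.gen ^ 2⟯ K).injective]
    exact hintα.pow 2) he hde
  rw [adjoin.powerBasis_gen] at hmax
  have hL := integralLattice_isSelfDual hgen hform
  have hL' := integralLattice_isSelfDual hgen' hform'
  -- the bipartitions of both trees induce the same grading up to sign, so the lattice of the second
  -- tree is also graded by that of the first
  have hgr' : ∀ x ∈ integralLattice ev', (1 / 2 : ℚ) • (x + signChange ev d x) ∈
      integralLattice ev' := by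
    intro x hx
    have h := half_add_signChange_mem d' hx
    rcases hδ.eq_or_eq_neg hδ' hnd with h2 | h2
    · rwa [h2] at h
    · rw [h2] at h
      have h3 := sub_mem hx h
      convert h3 using 1
      rw [LinearMap.neg_apply]
      module
  have hle := hL.le hδ hgen0 hmax hL' (fun x hx => half_add_signChange_mem d hx) hgr'
  obtain ⟨σ, hσ⟩ := exists_equiv_of_integralLattice_le hcard hgen hform hgen' hform' hle
  refine ⟨⟨σ, fun {u v} => ?_⟩⟩
  have := hσ u v
  rw [Γ.adjMatrix_eq_zero_iff, Γ'.adjMatrix_eq_zero_iff] at this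
  exact (not_iff_not.1 this).symm
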